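/- An asymmetric norm on $\mathbb R^n$ is a function $\|\cdot\|:\mathbb R^n\to\mathbb R_{\ge 0}$ such that $\|x\|=0$ only for $x=0$, $\|\alpha x\|=\alpha\|x\|$ for all $\alpha\ge 0$, and $\|x+y\|\le\|x\|+\|y\|$. It is called a rational polyhedral norm if its unit ball $P=\{x : \|x\|\le 1\}$ is a convex polytope (the convex hull of finitely many points) all of whose vertices lie in $\mathbb Z^n$. Put $d(x,y)=\|y-x\|$. For a base point $x_0\in\mathbb R^n$, the horofunction compactification $\overline{\mathbb R^n}^{hor}$ of $\mathbb R^n$ with respect to $\|\cdot\|$ is the closure of the image of $$\psi:\mathbb R^n\to C(\mathbb R^n),\qquad \psi(x)=d(\cdot,x)-d(x_0,x),$$ in the space $C(\mathbb R^n)$ of continuous real functions with the compact-open topology. The polar set of $P$ is $P^\circ=\{v\in\mathbb R^n : \langle v,u\rangle\ge -1 \text{ for all } u\in P\}$. **Corollary.** Let $\|\cdot\|$ be a rational polyhedral norm on $\mathbb R^n$ with unit ball $P$. Then $P^\circ$ is bounded and, for every base point $x_0$, the map $\psi$ is a topological embedding and the horofunction compactification $\overline{\mathbb R^n}^{hor}$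 is homeomorphic to $P^\circ$. Thus $P^\circ$ is a bounded realization of the horofunction compactification of $\mathbb R^n$. -/

import Mathlib

/-- An asymmetric norm on a real vector space: a nonnegative, definite, positively homogeneous,
subadditive function. -/
structure AsymmetricNorm (E : Type*) [AddCommGroup E] [Module ℝ E] where
  toFun : E → ℝ
  nonneg : ∀ x, 0 ≤ toFun x
  eq_zero_of_map_eq_zero : ∀ x, toFun x = 0 → x = 0
  map_smul : ∀ (a : ℝ) (x : E), 0 ≤ a → toFun (a • x) = a * toFun x
  map_add_le : ∀ x y, toFun (x + y) ≤ toFun x + toFun y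

namespace AsymmetricNorm

variable {E : Type*} [AddCommGroup E] [Module ℝ E]

/-- The unit ball `{x | ‖x‖ ≤ 1}` of an asymmetric norm. -/
def unitBall (N : AsymmetricNorm E) : Set E := {x | N.toFun x ≤ 1}

/-- The asymmetric metric `d(x, y) = ‖y - x‖` of an asymmetric norm. -/
def dist (N : AsymmetricNorm E) (x y : E) : ℝ := N.toFun (y - x)

theorem convexOn_toFun (N : AsymmetricNorm E) : ConvexOn ℝ Set.univ N.toFun := by
  refine ⟨convex_univ, fun x _ y _ a b ha hb _ => ?_⟩
  have h := N.map_add_le (a • x) (b • y)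
  rw [N.map_smul a x ha, N.map_smul b y hb] at h
  simpa [smul_eq_mul] using h

/-- The distance to a fixed point is a continuous function on Euclidean space. -/
theorem continuous_dist {n : ℕ} (N : AsymmetricNorm (EuclideanSpace ℝ (Fin n)))
    (x : EuclideanSpace ℝ (Fin n)) : Continuous (fun z => N.dist z x) := by
  have h : Continuous N.toFun := by
    rw [← continuousOn_univ]
    exact N.convexOn_toFun.continuousOn isOpen_univ
  exact h.comp (continuous_const.sub continuous_id)

end AsymmetricNorm

/-- A convex polytope: the convex hull of finitely many points. -/
def IsConvexPolytope {n : ℕ} (P : Set (EuclideanSpace ℝ (Fin n))) : Prop :=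
  ∃ S : Set (EuclideanSpace ℝ (Fin n)), S.Finite ∧ P = convexHull ℝ S

/-- A rational convex polytope: a convex polytope all of whose vertices lie in `ℤⁿ`. -/
def IsRationalPolytope {n : ℕ} (P : Set (EuclideanSpace ℝ (Fin n))) : Prop :=
  IsConvexPolytope P ∧ ∀ v ∈ Set.extremePoints ℝ P, ∀ i, ∃ k : ℤ, v i = (k : ℝ)

/-- A rational polyhedral norm: an asymmetric norm whose unit ball is a rational polytope. -/
def AsymmetricNorm.IsRationalPolyhedral {n : ℕ}
    (N : AsymmetricNorm (EuclideanSpace ℝ (Fin n))) : Prop :=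
  IsRationalPolytope N.unitBall

/-- The polar set `{v | ⟨v, u⟩ ≥ -1 for all u ∈ P}`. -/
def polarSet {n : ℕ} (P : Set (EuclideanSpace ℝ (Fin n))) : Set (EuclideanSpace ℝ (Fin n)) :=
  {v | ∀ u ∈ P, -1 ≤ inner ℝ v u}

section Horofunction

variable {X : Type*} [TopologicalSpace X]

/-- The map `x ↦ d(·, x) - d(x₀, x)` into the continuous functions on `X`, which carry the
compact-open topology. -/
def horoMap (d : X → X → ℝ) (hd : ∀ x, Continuous (fun z => d z x)) (x₀ : X) (x : X) :
    C(X, ℝ) where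
  toFun z := d z x - d x₀ x
  continuous_toFun := (hd x).sub continuous_const

/-- The horofunction compactification with respect to the base point `x₀`: the closure of the
image of `x ↦ d(·, x) - d(x₀, x)` in `C(X, ℝ)`. -/
def horofunctionCompactification (d : X → X → ℝ) (hd : ∀ x, Continuous (fun z => d z x))
    (x₀ : X) : Set C(X, ℝ) :=
  closure (Set.range (horoMap d hd x₀))

end Horofunction

/-! ### Polyhedra cut out by slacks, and entropy minimisation -/

section SlackPolyhedron

variable {E : Type*} [NormedAddCommGroup E] [InnerProductSpace ℝ E]

/-! Write `P = conv S`. The polar `K` is cut out by the slacks `l_s(v) = 1 + ⟨v, s⟩ ≥ 0`; being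
bounded, it is `conv W` for a finite `W`, and `‖x‖ = max_{w ∈ W} ⟨w, -x⟩`. The homeomorphism is an
explicit moment-map type parametrization. To `v ∈ K` attach `Φ_v(z) = log max_w ∏ l_s(v)^{l_s(w)}
exp⟨w, z⟩`, normalised to vanish at `x₀`.

If all slacks of `v` are positive, the product is the exponential of an affine function of `w`, and
`Φ_v(z) = const + ‖x - z‖` with `x = -∑ log l_s(v) s`; normalised, this is `ψ(x)`
(`toricPotential_of_pos`). Every `x` arises so: the equation for `v` is the critical point equation
of a tilted entropy on `K` (`exists_sum_log_slack_smul_eq`).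

The exponents `l_s(w)` are nonnegative, so the formula stays continuous on the boundary of `K`. It
is injective modulo constants by a relative entropy argument (`slack_eq_of_toricPotential_eq`).
Since `K` is compact, `v ↦ Φ_v` is a closed embedding; points with positive slacks are dense, so its
image is the closure of the image of `ψ`. -/

/-- The affine function `v ↦ 1 + ⟨v, s⟩`. -/
noncomputable def slack (s v : E) : ℝ := 1 + inner ℝ v s

/-- The polyhedron of all `v` with `-1 ≤ ⟨v, s⟩` for every `s ∈ S`. -/
def slackPolyhedron (S : Finset E) : Set E := {v | ∀ s ∈ S, 0 ≤ slack s v}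

theorem slack_zero (s : E) : slack s 0 = 1 := by simp [slack]

theorem slack_combo (s v w : E) {a b : ℝ} (hab : a + b = 1) :
    slack s (a • v + b • w) = a * slack s v + b * slack s w := by
  simp only [slack, inner_add_left, real_inner_smul_left]
  linear_combination (-1 : ℝ) * hab

theorem slack_smul (s v : E) (a : ℝ) : slack s (a • v) = a * slack s v + (1 - a) := by
  simp only [slack, real_inner_smul_left]
  ring

theorem slack_add_smul (s v w : E) (a : ℝ) : slack s (v + a • w) = slack s v + a * inner ℝ w s := by
  simp only [slack, inner_add_left, real_inner_smul_left]
  ring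

theorem continuous_slack (s : E) : Continuous (slack s) := by
  unfold slack
  fun_prop

theorem zero_mem_slackPolyhedron (S : Finset E) : (0 : E) ∈ slackPolyhedron S := fun s _ => by
  rw [slack_zero]
  exact zero_le_one

theorem convex_slackPolyhedron (S : Finset E) : Convex ℝ (slackPolyhedron S) := by
  intro v hv w hw a b ha hb hab s hs
  rw [slack_combo s v w hab]
  exact add_nonneg (mul_nonneg ha (hv s hs)) (mul_nonneg hb (hw s hs))

theorem isClosed_slackPolyhedron (S : Finset E) : IsClosed (slackPolyhedron S) := by
  have : slackPolyhedron S = ⋂ s ∈ S, {v | 0 ≤ slack s v} := by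
    ext v
    simp [slackPolyhedron]
  rw [this]
  exact isClosed_biInter fun s _ => isClosed_le continuous_const (continuous_slack s)

theorem smul_mem_slackPolyhedron_pos {S : Finset E} {v : E} (hv : v ∈ slackPolyhedron S) {a : ℝ}
    (ha : 0 ≤ a) (ha1 : a < 1) : ∀ s ∈ S, 0 < slack s (a • v) := fun s hs => by
  rw [slack_smul]
  have := mul_nonneg ha (hv s hs)
  linarith

/-- A point of the polyhedron may be moved a little in a direction along which the vanishing
slacks stay constant. -/
theorem eventually_add_smul_mem {S : Finset E} {v d : E} (hv : v ∈ slackPolyhedron S)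
    (hd : ∀ s ∈ S, slack s v = 0 → inner ℝ d s = 0) :
    ∀ᶠ a : ℝ in nhds 0, v + a • d ∈ slackPolyhedron S := by
  have h : ∀ s ∈ S, ∀ᶠ a : ℝ in nhds 0, 0 ≤ slack s (v + a • d) := by
    intro s hs
    rcases (hv s hs).eq_or_lt with h0 | h0
    · refine Filter.Eventually.of_forall fun a => ?_
      rw [slack_add_smul, hd s hs h0.symm, ← h0]
      simp
    · have hc : Filter.Tendsto (fun a : ℝ => slack s (v + a • d)) (nhds 0) (nhds (slack s v)) := by
        have : Continuous fun a : ℝ => slack s (v + a • d) :=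
          (continuous_slack s).comp (by fun_prop)
        simpa using this.tendsto 0
      exact (hc.eventually_const_lt h0).mono fun _ => le_of_lt
  exact (Filter.eventually_all_finset S).2 h

/-- A polyhedron has finitely many extreme points: each is determined by its vanishing slacks. -/
theorem finite_extremePoints_slackPolyhedron (S : Finset E) :
    (Set.extremePoints ℝ (slackPolyhedron S)).Finite := by
  classical
  refine Set.Finite.of_finite_image (f := fun v => S.filter fun s => slack s v = 0)
    (Set.Finite.subset (S.powerset.finite_toSet) ?_) ?_
  · rintro _ ⟨v, -, rfl⟩
    exact Finset.mem_coe.2 (Finset.mem_powerset.2 (Finset.filter_subset _ _))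
  · intro v hv w hw hvw
    have hiff : ∀ s ∈ S, slack s v = 0 → slack s w = 0 := by
      intro s hs h0
      have : s ∈ S.filter fun s => slack s v = 0 := Finset.mem_filter.2 ⟨hs, h0⟩
      rw [show S.filter (fun s => slack s v = 0) = S.filter (fun s => slack s w = 0) from hvw]
        at this
      exact (Finset.mem_filter.1 this).2
    have hd : ∀ s ∈ S, slack s v = 0 → inner ℝ (w - v) s = 0 := by
      intro s hs h0
      have h1 := hiff s hs h0
      simp only [slack] at h0 h1
      rw [inner_sub_left]
      linarith
    have hd' : ∀ s ∈ S, slack s v = 0 → inner ℝ (v - w) s = 0 := by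
      intro s hs h0
      have h1 := hd s hs h0
      rw [inner_sub_left] at h1 ⊢
      linarith
    -- If `v ≠ w` had the same vanishing slacks, `v` would be the midpoint of `v ± ε(w - v)`, both
    -- in the polyhedron.
    obtain ⟨ε, hε, hε0⟩ := (((eventually_add_smul_mem hv.1 hd).and
      (eventually_add_smul_mem hv.1 hd')).filter_mono nhdsWithin_le_nhds |>.and
        (self_mem_nhdsWithin (s := Set.Ioi (0 : ℝ)))).exists
    have hε0 : 0 < ε := hε0
    have hmem : v ∈ openSegment ℝ (v + ε • (w - v)) (v + ε • (v - w)) := by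
      refine ⟨1 / 2, 1 / 2, by norm_num, by norm_num, by norm_num, ?_⟩
      module
    have := hv.2 hε.1 hε.2 hmem
    have h0 : ε • (w - v) = 0 := by simpa using this
    rcases smul_eq_zero.1 h0 with h | h
    · exact absurd h hε0.ne'
    · exact (sub_eq_zero.1 h).symm

/-- A bounded polyhedron is the convex hull of finitely many points. -/
theorem exists_convexHull_eq_slackPolyhedron [FiniteDimensional ℝ E] {S : Finset E}
    (hS : Bornology.IsBounded (slackPolyhedron S)) :
    ∃ W : Finset E, W.Nonempty ∧ convexHull ℝ (W : Set E) = slackPolyhedron S := by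
  have hfin := finite_extremePoints_slackPolyhedron S
  have hK : IsCompact (slackPolyhedron S) :=
    Metric.isCompact_of_isClosed_isBounded (isClosed_slackPolyhedron S) hS
  refine ⟨hfin.toFinset, ?_, ?_⟩
  · rw [Set.Finite.toFinset_nonempty]
    exact hK.extremePoints_nonempty ⟨0, zero_mem_slackPolyhedron S⟩
  · rw [Set.Finite.coe_toFinset]
    have := closure_convexHull_extremePoints hK (convex_slackPolyhedron S)
    rwa [(hfin.isCompact_convexHull ℝ).isClosed.closure_eq] at this

/-- The entropy `∑ l log l` of the slacks, tilted by a linear function, has its minimum at a point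
where no slack vanishes. -/
theorem exists_sum_log_slack_smul_eq {S : Finset E} (hK : IsCompact (slackPolyhedron S)) (y : E) :
    ∃ v, (∀ s ∈ S, 0 < slack s v) ∧ ∑ s ∈ S, (Real.log (slack s v) + 1) • s = -y := by
  classical
  set F : E → ℝ := fun v => ∑ s ∈ S, slack s v * Real.log (slack s v) + inner ℝ v y with hF
  have hFc : Continuous F := by
    refine Continuous.add (continuous_finsetSum _ fun s _ => ?_) (by fun_prop)
    exact Real.continuous_mul_log.comp (continuous_slack s)
  obtain ⟨v, hvK, hmin⟩ :=
    hK.exists_isMinOn ⟨0, zero_mem_slackPolyhedron S⟩ hFc.continuousOn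
  have hpos : ∀ s ∈ S, 0 < slack s v := by
    intro s₀ hs₀
    refine (hvK s₀ hs₀).lt_of_ne fun h0 => ?_
    -- Moving from `v` towards `0` by `t` turns the vanishing slack into exactly `t`, contributing
    -- `t log t`. Convexity of `x log x`, which is `0` at `1`, controls the other terms. The
    -- infinite slope of `x log x` at `0` then contradicts minimality.
    have key : ∀ t : ℝ, 0 < t → t < 1 → F v - F 0 ≤ Real.log t := by
      intro t ht ht1
      have hle : F v ≤ F ((1 - t) • v) := hmin fun s hs =>
        (smul_mem_slackPolyhedron_pos hvK (by linarith) (by linarith) s hs).le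
      have hterm : ∀ s ∈ S, slack s ((1 - t) • v) * Real.log (slack s ((1 - t) • v)) ≤
          (1 - t) * (slack s v * Real.log (slack s v)) +
            if s = s₀ then t * Real.log t else 0 := by
        intro s hs
        rw [slack_smul]
        split_ifs with h
        · subst h
          rw [← h0]
          simp
        · have := Real.convexOn_mul_log.2 (Set.mem_Ici.2 (hvK s hs))
            (Set.mem_Ici.2 (zero_le_one : (0 : ℝ) ≤ 1)) (show 0 ≤ 1 - t by linarith) ht.le (by ring)
          simpa using this
      have hsum := Finset.sum_le_sum hterm
      rw [Finset.sum_add_distrib, ← Finset.mul_sum, Finset.sum_ite_eq' S s₀, if_pos hs₀] at hsum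
      have hF0 : F 0 = 0 := by simp [hF, slack_zero]
      have h2 : F ((1 - t) • v) ≤ (1 - t) * F v + t * Real.log t := by
        simp only [hF, real_inner_smul_left]
        linarith
      have h3 : t * F v ≤ t * Real.log t := by linarith
      rw [hF0, sub_zero]
      exact le_of_mul_le_mul_left h3 ht
    obtain ⟨t, ht, ht0, ht1⟩ := ((Real.tendsto_log_nhdsGT_zero.eventually_lt_atBot (F v - F 0)).and
      (Ioo_mem_nhdsGT (zero_lt_one (α := ℝ)))).exists
    exact absurd (key t ht0 ht1) (not_le.2 ht)
  refine ⟨v, hpos, ?_⟩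
  have hcrit : ∀ d : E, inner ℝ d (∑ s ∈ S, (Real.log (slack s v) + 1) • s + y) = 0 := by
    intro d
    have hd : HasDerivAt (fun a : ℝ => F (v + a • d))
        (∑ s ∈ S, (Real.log (slack s v) + 1) * inner ℝ d s + inner ℝ d y) 0 := by
      have hlin : ∀ (s : E) (c : ℝ),
          HasDerivAt (fun a : ℝ => c + a * inner ℝ d s) (inner ℝ d s) 0 := fun s c => by
        simpa using ((hasDerivAt_id (0 : ℝ)).mul_const (inner ℝ d s)).const_add c
      simp only [hF, slack_add_smul, inner_add_left, real_inner_smul_left]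
      refine HasDerivAt.add (HasDerivAt.fun_sum fun s hs => ?_) (hlin y _)
      have h := Real.hasDerivAt_mul_log (hpos s hs).ne'
      have h' := HasDerivAt.comp (0 : ℝ) (h₂ := fun x => x * Real.log x)
        (h := fun a : ℝ => slack s v + a * inner ℝ d s) (by simpa using h) (hlin s (slack s v))
      exact h'
    have hloc : IsLocalMin (fun a : ℝ => F (v + a • d)) 0 := by
      filter_upwards [eventually_add_smul_mem hvK (d := d)
        fun s hs h0 => absurd h0 (hpos s hs).ne'] with a ha
      simpa using hmin ha
    have := hloc.hasDerivAt_eq_zero hd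
    rw [inner_add_right, inner_sum]
    simpa [real_inner_smul_right] using this
  exact eq_neg_of_add_eq_zero_left (inner_self_eq_zero.1 (hcrit _))

end SlackPolyhedron

/-! ### The toric potential, its continuity and its injectivity -/

section ToricPotential

variable {E : Type*} [NormedAddCommGroup E] [InnerProductSpace ℝ E]

/-- The monomial `∏ s, l_s(v) ^ l_s(w)` in the slacks `l_s`. -/
noncomputable def slackWeight (S : Finset E) (v w : E) : ℝ := ∏ s ∈ S, slack s v ^ slack s w

/-- The logarithm of `max_w ∏ s, l_s(v) ^ l_s(w) * exp ⟨w, z⟩`, the maximum running over `W`. -/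
noncomputable def toricPotential (S W : Finset E) (hW : W.Nonempty) (v z : E) : ℝ :=
  Real.log (W.sup' hW fun w => slackWeight S v w * Real.exp (inner ℝ w z))

theorem slackWeight_self_pos {S : Finset E} {v : E} (hv : v ∈ slackPolyhedron S) :
    0 < slackWeight S v v := by
  refine Finset.prod_pos fun s hs => ?_
  rcases (hv s hs).eq_or_lt with h | h
  · rw [← h]
    simp
  · exact Real.rpow_pos_of_pos h _

theorem log_slackWeight_self {S : Finset E} {v : E} (hv : v ∈ slackPolyhedron S) :
    Real.log (slackWeight S v v) = ∑ s ∈ S, slack s v * Real.log (slack s v) := by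
  rw [slackWeight, Real.log_prod]
  · refine Finset.sum_congr rfl fun s hs => ?_
    rcases (hv s hs).eq_or_lt with h | h
    · rw [← h]
      simp
    · rw [Real.log_rpow h]
  · exact Finset.prod_ne_zero_iff.1 (slackWeight_self_pos hv).ne'

theorem slackWeight_nonneg {S : Finset E} {v : E} (hv : v ∈ slackPolyhedron S) (w : E) :
    0 ≤ slackWeight S v w :=
  Finset.prod_nonneg fun s hs => Real.rpow_nonneg (hv s hs) _

theorem slackWeight_combo {S : Finset E} {v w w' : E} (hv : v ∈ slackPolyhedron S)
    (hw : w ∈ slackPolyhedron S) (hw' : w' ∈ slackPolyhedron S) {a b : ℝ} (ha : 0 ≤ a)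
    (hb : 0 ≤ b) (hab : a + b = 1) :
    slackWeight S v (a • w + b • w') = slackWeight S v w ^ a * slackWeight S v w' ^ b := by
  simp only [slackWeight]
  rw [← Real.finsetProd_rpow _ _ fun s hs => Real.rpow_nonneg (hv s hs) _,
    ← Real.finsetProd_rpow _ _ fun s hs => Real.rpow_nonneg (hv s hs) _,
    ← Finset.prod_mul_distrib]
  refine Finset.prod_congr rfl fun s hs => ?_
  rw [slack_combo s w w' hab, Real.rpow_add_of_nonneg (hv s hs) (mul_nonneg ha (hw s hs))
    (mul_nonneg hb (hw' s hs)), ← Real.rpow_mul (hv s hs), ← Real.rpow_mul (hv s hs),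
    mul_comm a, mul_comm b]

/-- In `w` the expression turns convex combinations into weighted geometric means, so its sublevel
sets are convex and a bound on `W` spreads to the hull. Taking `w = v` then shows that the maximum
is positive, so its logarithm is continuous even on the boundary. -/
theorem slackWeight_mul_exp_le {S W : Finset E} (hW : W.Nonempty)
    (hWS : convexHull ℝ (W : Set E) = slackPolyhedron S) {v w : E} (hv : v ∈ slackPolyhedron S)
    (hw : w ∈ slackPolyhedron S) (z : E) :
    slackWeight S v w * Real.exp (inner ℝ w z) ≤
      W.sup' hW fun w => slackWeight S v w * Real.exp (inner ℝ w z) := by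
  set M := W.sup' hW fun w => slackWeight S v w * Real.exp (inner ℝ w z)
  have hf : ∀ w, 0 ≤ slackWeight S v w * Real.exp (inner ℝ w z) := fun w =>
    mul_nonneg (slackWeight_nonneg hv w) (Real.exp_pos _).le
  have hM : 0 ≤ M := by
    obtain ⟨w₀, hw₀⟩ := hW
    exact (hf w₀).trans (Finset.le_sup' (fun w => slackWeight S v w * Real.exp (inner ℝ w z)) hw₀)
  have hconv : Convex ℝ {w | w ∈ slackPolyhedron S ∧
      slackWeight S v w * Real.exp (inner ℝ w z) ≤ M} := by
    rintro w ⟨hw, hwM⟩ w' ⟨hw', hwM'⟩ a b ha hb hab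
    refine ⟨convex_slackPolyhedron S hw hw' ha hb hab, ?_⟩
    have : slackWeight S v (a • w + b • w') * Real.exp (inner ℝ (a • w + b • w') z) =
        (slackWeight S v w * Real.exp (inner ℝ w z)) ^ a *
          (slackWeight S v w' * Real.exp (inner ℝ w' z)) ^ b := by
      rw [slackWeight_combo hv hw hw' ha hb hab, Real.mul_rpow (slackWeight_nonneg hv w)
        (Real.exp_pos _).le, Real.mul_rpow (slackWeight_nonneg hv w') (Real.exp_pos _).le,
        ← Real.exp_mul, ← Real.exp_mul, inner_add_left, real_inner_smul_left,
        real_inner_smul_left, Real.exp_add, mul_comm a, mul_comm b]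
      ring
    rw [this]
    calc _ ≤ M ^ a * M ^ b := mul_le_mul (Real.rpow_le_rpow (hf w) hwM ha)
          (Real.rpow_le_rpow (hf w') hwM' hb) (Real.rpow_nonneg (hf w') _) (Real.rpow_nonneg hM _)
      _ = M := by rw [← Real.rpow_add_of_nonneg hM ha hb, hab, Real.rpow_one]
  have hsub : (W : Set E) ⊆ {w | w ∈ slackPolyhedron S ∧
      slackWeight S v w * Real.exp (inner ℝ w z) ≤ M} := fun w₀ hw₀ =>
    ⟨hWS ▸ subset_convexHull ℝ _ hw₀,
      Finset.le_sup' (fun w => slackWeight S v w * Real.exp (inner ℝ w z)) hw₀⟩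
  exact (convexHull_min hsub hconv (hWS.symm ▸ hw)).2

theorem sup'_slackWeight_pos {S W : Finset E} (hW : W.Nonempty)
    (hWS : convexHull ℝ (W : Set E) = slackPolyhedron S) {v : E} (hv : v ∈ slackPolyhedron S)
    (z : E) : 0 < W.sup' hW fun w => slackWeight S v w * Real.exp (inner ℝ w z) :=
  (mul_pos (slackWeight_self_pos hv) (Real.exp_pos _)).trans_le
    (slackWeight_mul_exp_le hW hWS hv hv z)

theorem continuous_toricPotential {S W : Finset E} (hW : W.Nonempty)
    (hWS : convexHull ℝ (W : Set E) = slackPolyhedron S) :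
    Continuous fun p : slackPolyhedron S × E => toricPotential S W hW p.1 p.2 := by
  refine Continuous.log (Continuous.finset_sup'_apply hW fun w hw => ?_) fun p =>
    (sup'_slackWeight_pos hW hWS p.1.2 p.2).ne'
  refine Continuous.mul (continuous_finsetProd _ fun s hs => ?_) (by fun_prop)
  have hwK : w ∈ slackPolyhedron S := hWS ▸ subset_convexHull ℝ _ hw
  exact ((continuous_slack s).comp (by fun_prop)).rpow_const fun _ => Or.inr (hwK s hs)

theorem inner_sum_smul_eq (S : Finset E) (c : E → ℝ) (w : E) :
    inner ℝ w (∑ s ∈ S, c s • s) = ∑ s ∈ S, c s * slack s w - ∑ s ∈ S, c s := by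
  rw [inner_sum, ← Finset.sum_sub_distrib]
  refine Finset.sum_congr rfl fun s _ => ?_
  rw [real_inner_smul_right, slack]
  ring

/-- Lower bound from the single competitor `w = v`. -/
theorem le_toricPotential {S W : Finset E} (hW : W.Nonempty)
    (hWS : convexHull ℝ (W : Set E) = slackPolyhedron S) {v : E} (hv : v ∈ slackPolyhedron S)
    (c : E → ℝ) :
    ∑ s ∈ S, slack s v * (Real.log (slack s v) + c s) - ∑ s ∈ S, c s ≤
      toricPotential S W hW v (∑ s ∈ S, c s • s) := by
  have h := Real.log_le_log (mul_pos (slackWeight_self_pos hv) (Real.exp_pos _))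
    (slackWeight_mul_exp_le hW hWS hv hv (∑ s ∈ S, c s • s))
  rw [Real.log_mul (slackWeight_self_pos hv).ne' (Real.exp_pos _).ne', Real.log_exp,
    log_slackWeight_self hv, inner_sum_smul_eq] at h
  refine le_trans (le_of_eq ?_) h
  rw [← add_sub_assoc, ← Finset.sum_add_distrib]
  congr 1
  exact Finset.sum_congr rfl fun s _ => by ring

/-- This `c` makes each factor `l_s(v)^{l_s(w)} exp(c_s l_s(w))` equal to `1` where `l_s(v) > 0`;
where `l_s(v) = 0` it is `0`, or `0 ^ 0 = 1`, so `c_s` is free there. -/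
theorem toricPotential_le {S W : Finset E} (hW : W.Nonempty)
    (hWS : convexHull ℝ (W : Set E) = slackPolyhedron S) {v : E} (hv : v ∈ slackPolyhedron S)
    (c : E → ℝ) (hc : ∀ s ∈ S, slack s v ≠ 0 → c s = -Real.log (slack s v)) :
    toricPotential S W hW v (∑ s ∈ S, c s • s) ≤ -∑ s ∈ S, c s := by
  rw [toricPotential, Real.log_le_iff_le_exp (sup'_slackWeight_pos hW hWS hv _)]
  refine Finset.sup'_le hW _ fun w hw => ?_
  have hwK : w ∈ slackPolyhedron S := hWS ▸ subset_convexHull ℝ _ hw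
  rw [inner_sum_smul_eq, sub_eq_add_neg, Real.exp_add, ← mul_assoc]
  refine mul_le_of_le_one_left (Real.exp_pos _).le ?_
  rw [slackWeight, Real.exp_sum, ← Finset.prod_mul_distrib]
  refine Finset.prod_le_one (fun s hs =>
    mul_nonneg (Real.rpow_nonneg (hv s hs) _) (Real.exp_pos _).le) fun s hs => ?_
  rcases (hv s hs).eq_or_lt with h | h
  · rw [← h]
    rcases (hwK s hs).eq_or_lt with h' | h'
    · rw [← h']
      simp
    · rw [Real.zero_rpow h'.ne', zero_mul]
      exact zero_le_one
  · rw [hc s hs h.ne', Real.rpow_def_of_pos h, ← Real.exp_add]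
    simp

/-- Equality of two potentials up to a constant bounds the relative entropy of the slacks. -/
theorem relativeEntropy_le {S W : Finset E} (hW : W.Nonempty)
    (hWS : convexHull ℝ (W : Set E) = slackPolyhedron S) {v v' : E} (hv : v ∈ slackPolyhedron S)
    (hv' : v' ∈ slackPolyhedron S) {k : ℝ}
    (hk : ∀ z, toricPotential S W hW v' z = toricPotential S W hW v z + k) :
    (∀ s ∈ S, slack s v = 0 → slack s v' = 0) ∧
      ∑ s ∈ S, slack s v' * (Real.log (slack s v') - Real.log (slack s v)) ≤ k := by
  classical
  set D := ∑ s ∈ S, slack s v' * (Real.log (slack s v') - Real.log (slack s v)) with hD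
  set M := ∑ s ∈ S, if slack s v = 0 then slack s v' else 0 with hM
  have hbound : ∀ t : ℝ, D + t * M ≤ k := by
    intro t
    -- The free value on vanishing slacks is `t`, since `Real.log 0 = 0`. As `t` is arbitrary, its
    -- coefficient `M` must vanish.
    set c : E → ℝ := fun s => -Real.log (slack s v) + if slack s v = 0 then t else 0 with hc
    have h1 := le_toricPotential hW hWS hv' c
    have h2 := toricPotential_le hW hWS hv c fun s _ hs => by simp [hc, hs]
    have h3 := hk (∑ s ∈ S, c s • s)
    have h4 : ∑ s ∈ S, slack s v' * (Real.log (slack s v') + c s) = D + t * M := by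
      rw [hD, hM, Finset.mul_sum, ← Finset.sum_add_distrib]
      refine Finset.sum_congr rfl fun s _ => ?_
      simp only [hc]
      split_ifs <;> ring
    linarith
  have hnn : ∀ s ∈ S, 0 ≤ if slack s v = 0 then slack s v' else 0 := fun s hs => by
    split_ifs
    exacts [hv' s hs, le_rfl]
  have hM0 : M = 0 := by
    by_contra hne
    have h := hbound ((k - D + 1) / M)
    rw [div_mul_cancel₀ _ hne] at h
    linarith
  refine ⟨fun s hs h0 => ?_, by simpa using hbound 0⟩
  simpa [h0] using (Finset.sum_eq_zero_iff_of_nonneg hnn).1 hM0 s hs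

/-- The potential determines the slacks. -/
theorem slack_eq_of_toricPotential_eq {S W : Finset E} (hW : W.Nonempty)
    (hWS : convexHull ℝ (W : Set E) = slackPolyhedron S) {v v' : E} (hv : v ∈ slackPolyhedron S)
    (hv' : v' ∈ slackPolyhedron S) {k : ℝ}
    (hk : ∀ z, toricPotential S W hW v' z = toricPotential S W hW v z + k) :
    ∀ s ∈ S, slack s v = slack s v' := by
  obtain ⟨hz, hle⟩ := relativeEntropy_le hW hWS hv hv' hk
  obtain ⟨hz', hle'⟩ := relativeEntropy_le hW hWS hv' hv (k := -k) fun z => by rw [hk z]; ring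
  have hpos : ∀ s ∈ S, slack s v ≠ slack s v' →
      0 < (slack s v' - slack s v) * (Real.log (slack s v') - Real.log (slack s v)) := by
    intro s hs hne
    have h1 : 0 < slack s v := (hv s hs).lt_of_ne fun h => hne (by rw [← h, hz s hs h.symm])
    have h2 : 0 < slack s v' := (hv' s hs).lt_of_ne fun h => hne (by rw [← h, hz' s hs h.symm])
    rcases hne.lt_or_gt with h | h
    · exact mul_pos (sub_pos.2 h) (sub_pos.2 (Real.log_lt_log h1 h))
    · exact mul_pos_of_neg_of_neg (sub_neg.2 h) (sub_neg.2 (Real.log_lt_log h2 h))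
  have hnn : ∀ s ∈ S,
      0 ≤ (slack s v' - slack s v) * (Real.log (slack s v') - Real.log (slack s v)) := by
    intro s hs
    by_cases h : slack s v = slack s v'
    · rw [h]
      simp
    · exact (hpos s hs h).le
  -- Adding the two relative entropy bounds cancels `k` and leaves the symmetrised divergence, whose
  -- terms are nonnegative.
  have hsum : ∑ s ∈ S,
      (slack s v' - slack s v) * (Real.log (slack s v') - Real.log (slack s v)) ≤ 0 := by
    have h := add_le_add hle hle'
    rw [← Finset.sum_add_distrib, add_neg_cancel] at h
    refine le_trans (le_of_eq (Finset.sum_congr rfl fun s _ => ?_)) h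
    ring
  intro s hs
  by_contra hne
  have h0 := (Finset.sum_eq_zero_iff_of_nonneg hnn).1 (le_antisymm hsum (Finset.sum_nonneg hnn))
  exact (hpos s hs hne).ne' (h0 s hs)

/-- Where no slack vanishes, the potential is a translate of the support function of `-W`. -/
theorem toricPotential_of_pos {S W : Finset E} (hW : W.Nonempty) {v : E}
    (hv : ∀ s ∈ S, 0 < slack s v) (z : E) :
    toricPotential S W hW v z = ∑ s ∈ S, Real.log (slack s v) +
      W.sup' hW fun w => inner ℝ w (-(-∑ s ∈ S, Real.log (slack s v) • s - z)) := by
  have hterm : ∀ w, slackWeight S v w * Real.exp (inner ℝ w z) =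
      Real.exp (∑ s ∈ S, Real.log (slack s v) +
        inner ℝ w (-(-∑ s ∈ S, Real.log (slack s v) • s - z))) := by
    intro w
    have h : slackWeight S v w = Real.exp (∑ s ∈ S, Real.log (slack s v) * slack s w) := by
      rw [Real.exp_sum]
      exact Finset.prod_congr rfl fun s hs => Real.rpow_def_of_pos (hv s hs) _
    rw [h, ← Real.exp_add, neg_sub, sub_neg_eq_add, inner_add_right, inner_sum_smul_eq]
    congr 1
    ring
  simp only [toricPotential, hterm]
  have hexp := Finset.apply_sup'_eq_sup'_comp hW
    (f := fun w => inner ℝ w (-(-∑ s ∈ S, Real.log (slack s v) • s - z)))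
    (fun r : ℝ => Real.exp (∑ s ∈ S, Real.log (slack s v) + r)) fun a b =>
      Monotone.map_max fun a b hab => Real.exp_le_exp.2 (by linarith)
  rw [← Real.log_exp (_ + W.sup' hW _)]
  exact congrArg Real.log hexp.symm

end ToricPotential

/-! ### Polar duality between the unit ball and the norm -/

section Duality

variable {n : ℕ}

theorem polarSet_convexHull (S : Finset (EuclideanSpace ℝ (Fin n))) :
    polarSet (convexHull ℝ (S : Set (EuclideanSpace ℝ (Fin n)))) = slackPolyhedron S := by
  ext v
  constructor
  · intro hv s hs
    have := hv s (subset_convexHull ℝ _ hs)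
    rw [slack]
    linarith
  · intro hv
    have hconv : Convex ℝ {u | -1 ≤ inner ℝ v u} :=
      convex_halfSpace_ge (f := fun u => inner ℝ v u)
        ⟨fun x y => inner_add_right v x y, fun c x => real_inner_smul_right v x c⟩ (-1)
    have hsub : (S : Set (EuclideanSpace ℝ (Fin n))) ⊆ {u | -1 ≤ inner ℝ v u} := fun s hs => by
      have := hv s hs
      rw [slack] at this
      simp only [Set.mem_ofPred_eq]
      linarith
    exact fun u hu => convexHull_min hsub hconv hu

namespace AsymmetricNorm

variable (N : AsymmetricNorm (EuclideanSpace ℝ (Fin n)))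

theorem toFun_zero : N.toFun 0 = 0 := by
  simpa using N.map_smul 0 0 le_rfl

theorem continuous_toFun : Continuous N.toFun := by
  rw [← continuousOn_univ]
  exact N.convexOn_toFun.continuousOn isOpen_univ

theorem convex_unitBall : Convex ℝ N.unitBall := by
  simpa [unitBall] using N.convexOn_toFun.convex_le 1

theorem inv_smul_mem_unitBall {x : EuclideanSpace ℝ (Fin n)} {r : ℝ} (hr : 0 < r)
    (hx : N.toFun x ≤ r) : r⁻¹ • x ∈ N.unitBall := by
  change N.toFun (r⁻¹ • x) ≤ 1
  rw [N.map_smul _ _ (inv_nonneg.2 hr.le)]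
  exact (inv_mul_le_iff₀ hr).2 (by simpa using hx)

theorem neg_inner_le {w : EuclideanSpace ℝ (Fin n)} (hw : w ∈ polarSet N.unitBall)
    (x : EuclideanSpace ℝ (Fin n)) : inner ℝ w (-x) ≤ N.toFun x := by
  rcases (N.nonneg x).eq_or_lt with h | h
  · rw [N.eq_zero_of_map_eq_zero x h.symm]
    simp [N.toFun_zero]
  · have := hw _ (N.inv_smul_mem_unitBall h le_rfl)
    rw [real_inner_smul_right, inv_mul_eq_div, le_div_iff₀ h] at this
    rw [inner_neg_right]
    linarith

theorem isBounded_polarSet_unitBall : Bornology.IsBounded (polarSet N.unitBall) := by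
  obtain ⟨C, hC⟩ := (isCompact_sphere (0 : EuclideanSpace ℝ (Fin n)) 1).bddAbove_image
    N.continuous_toFun.continuousOn
  rw [isBounded_iff_forall_norm_le]
  refine ⟨max C 0, fun w hw => ?_⟩
  by_cases h : w = 0
  · simp [h]
  · have hw0 : 0 < ‖w‖ := norm_pos_iff.2 h
    refine le_trans ?_ (le_max_left _ _)
    have h1 := N.neg_inner_le hw (-(‖w‖⁻¹ • w))
    rw [neg_neg, real_inner_smul_right, real_inner_self_eq_norm_sq] at h1
    have h2 : N.toFun (-(‖w‖⁻¹ • w)) ≤ C := hC ⟨_, by simp [norm_smul, hw0.ne'], rfl⟩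
    have h3 : ‖w‖⁻¹ * ‖w‖ ^ 2 = ‖w‖ := by field_simp
    linarith

/-- The bipolar theorem for the unit ball. -/
theorem toFun_le_one_of_forall_polarSet {x : EuclideanSpace ℝ (Fin n)}
    (hx : ∀ w ∈ polarSet N.unitBall, inner ℝ w (-x) ≤ 1) : N.toFun x ≤ 1 := by
  by_contra hcon
  obtain ⟨f, u, hfu, hux⟩ := geometric_hahn_banach_closed_point N.convex_unitBall
    (isClosed_le N.continuous_toFun continuous_const) (x := x) hcon
  have hu : 0 < u := by
    simpa using hfu 0 (by simp [unitBall, N.toFun_zero])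
  obtain ⟨g, rfl⟩ := (InnerProductSpace.toDual ℝ (EuclideanSpace ℝ (Fin n))).surjective f
  simp only [InnerProductSpace.toDual_apply_apply] at hfu hux
  have hmem : -(u⁻¹ • g) ∈ polarSet N.unitBall := by
    intro a ha
    rw [inner_neg_left, real_inner_smul_left, neg_le_neg_iff]
    exact (inv_mul_le_iff₀ hu).2 (by simpa using (hfu a ha).le)
  have := hx _ hmem
  rw [inner_neg_neg, real_inner_smul_left, inv_mul_le_iff₀ hu, mul_one] at this
  linarith

theorem toFun_eq_sup' {W : Finset (EuclideanSpace ℝ (Fin n))} (hW : W.Nonempty)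
    (hWP : convexHull ℝ (W : Set (EuclideanSpace ℝ (Fin n))) = polarSet N.unitBall)
    (x : EuclideanSpace ℝ (Fin n)) : N.toFun x = W.sup' hW fun w => inner ℝ w (-x) := by
  refine le_antisymm ?_ (Finset.sup'_le hW _ fun w hw =>
    N.neg_inner_le (hWP ▸ subset_convexHull ℝ _ hw) x)
  have hle : ∀ w ∈ polarSet N.unitBall, inner ℝ w (-x) ≤ W.sup' hW fun w => inner ℝ w (-x) := by
    intro w hw
    have hconv : Convex ℝ {w | inner ℝ w (-x) ≤ W.sup' hW fun w => inner ℝ w (-x)} :=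
      convex_halfSpace_le (f := fun w => inner ℝ w (-x))
        ⟨fun a b => inner_add_left a b _, fun c a => real_inner_smul_left a _ c⟩ _
    exact convexHull_min (fun w hw => Finset.le_sup' (fun w => inner ℝ w (-x)) hw) hconv
      (hWP.symm ▸ hw)
  -- The maximum itself may be `0`; any larger `r` is positive and can be scaled out.
  refine le_of_forall_gt_imp_ge_of_dense fun r hr => ?_
  have hr0 : 0 < r := by
    have h0 : (0 : EuclideanSpace ℝ (Fin n)) ∈ polarSet N.unitBall := fun u _ => by simp
    exact lt_of_le_of_lt (by simpa using hle 0 h0) hr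
  have h1 : N.toFun (r⁻¹ • x) ≤ 1 := N.toFun_le_one_of_forall_polarSet fun w hw => by
    rw [← smul_neg, real_inner_smul_right, inv_mul_le_iff₀ hr0, mul_one]
    exact (hle w hw).trans hr.le
  rwa [N.map_smul _ _ (inv_nonneg.2 hr0.le), inv_mul_le_iff₀ hr0, mul_one] at h1

/-- A vector orthogonal to `S` is orthogonal to the unit ball, which contains a positive multiple of
that vector. -/
theorem eq_of_forall_slack_eq {S : Finset (EuclideanSpace ℝ (Fin n))}
    (hS : N.unitBall = convexHull ℝ (S : Set (EuclideanSpace ℝ (Fin n))))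
    {v v' : EuclideanSpace ℝ (Fin n)} (h : ∀ s ∈ S, slack s v = slack s v') : v = v' := by
  have hP : ∀ u ∈ N.unitBall, inner ℝ (v - v') u = 0 := by
    have hconv : Convex ℝ {u | inner ℝ (v - v') u = 0} :=
      convex_hyperplane (f := fun u => inner ℝ (v - v') u)
        ⟨fun x y => inner_add_right _ x y, fun c x => real_inner_smul_right _ x c⟩ 0
    have hsub : (S : Set (EuclideanSpace ℝ (Fin n))) ⊆ {u | inner ℝ (v - v') u = 0} :=
      fun s hs => by
        have := h s hs
        simp only [slack] at this
        rw [Set.mem_ofPred_eq, inner_sub_left]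
        linarith
    rw [hS]
    exact fun u hu => convexHull_min hsub hconv hu
  have hr : 0 < N.toFun (v - v') + 1 := by
    have := N.nonneg (v - v')
    linarith
  have h0 := hP _ (N.inv_smul_mem_unitBall hr (by linarith))
  rw [real_inner_smul_right] at h0
  rcases mul_eq_zero.1 h0 with h1 | h1
  · exact absurd h1 (inv_pos.2 hr).ne'
  · exact sub_eq_zero.1 (inner_self_eq_zero.1 h1)

end AsymmetricNorm

end Duality

/-! ### Embedding the polar set as the horofunction compactification -/

section Compactification

/-- The horofunction attached to a point of the polyhedron. -/
noncomputable def toricHorofunction {E : Type*} [NormedAddCommGroup E] [InnerProductSpace ℝ E]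
    {S W : Finset E} (hW : W.Nonempty)
    (hWS : convexHull ℝ (W : Set E) = slackPolyhedron S) (x₀ : E) (v : slackPolyhedron S) :
    C(E, ℝ) where
  toFun z := toricPotential S W hW v z - toricPotential S W hW v x₀
  continuous_toFun := ((continuous_toricPotential hW hWS).comp
    (by fun_prop : Continuous fun z : E => (v, z))).sub continuous_const

theorem continuous_toricHorofunction {E : Type*} [NormedAddCommGroup E] [InnerProductSpace ℝ E]
    {S W : Finset E} (hW : W.Nonempty)
    (hWS : convexHull ℝ (W : Set E) = slackPolyhedron S) (x₀ : E) :
    Continuous (toricHorofunction hW hWS x₀) := by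
  refine ContinuousMap.continuous_of_continuous_uncurry _ ?_
  exact (continuous_toricPotential hW hWS).sub ((continuous_toricPotential hW hWS).comp
    (by fun_prop : Continuous fun p : slackPolyhedron S × E => (p.1, x₀)))

/-- Shrinking towards the origin, where every slack is `1`, makes all slacks positive. -/
theorem dense_slack_pos {E : Type*} [NormedAddCommGroup E] [InnerProductSpace ℝ E] (S : Finset E) :
    Dense {v : slackPolyhedron S | ∀ s ∈ S, 0 < slack s (v : E)} := by
  intro v
  have ht : ∀ k : ℕ, 0 ≤ 1 - 1 / ((k : ℝ) + 1) ∧ 1 - 1 / ((k : ℝ) + 1) < 1 := fun k => by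
    have h1 : 0 < 1 / ((k : ℝ) + 1) := by positivity
    have h2 : 1 / ((k : ℝ) + 1) ≤ 1 := by
      rw [div_le_one (by positivity)]
      linarith [(Nat.cast_nonneg k : (0 : ℝ) ≤ k)]
    constructor <;> linarith
  have hpos := fun k => smul_mem_slackPolyhedron_pos v.2 (ht k).1 (ht k).2
  refine mem_closure_of_tendsto (b := Filter.atTop)
    (f := fun k : ℕ => (⟨(1 - 1 / ((k : ℝ) + 1)) • (v : E), fun s hs => (hpos k s hs).le⟩ :
      slackPolyhedron S)) ?_ (Filter.Eventually.of_forall hpos)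
  rw [tendsto_subtype_rng]
  have := (tendsto_one_div_add_atTop_nhds_zero_nat (𝕜 := ℝ)).const_sub 1 |>.smul_const (v : E)
  simpa using this

variable {n : ℕ} (N : AsymmetricNorm (EuclideanSpace ℝ (Fin n)))
  {S W : Finset (EuclideanSpace ℝ (Fin n))}

theorem toricHorofunction_injective (hW : W.Nonempty)
    (hWS : convexHull ℝ (W : Set (EuclideanSpace ℝ (Fin n))) = slackPolyhedron S)
    (hS : N.unitBall = convexHull ℝ (S : Set (EuclideanSpace ℝ (Fin n))))
    (x₀ : EuclideanSpace ℝ (Fin n)) : Function.Injective (toricHorofunction hW hWS x₀) := by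
  intro v v' h
  refine Subtype.ext (N.eq_of_forall_slack_eq hS (slack_eq_of_toricPotential_eq hW hWS v.2 v'.2
    (k := toricPotential S W hW v' x₀ - toricPotential S W hW v x₀) fun z => ?_))
  have hz : toricPotential S W hW v z - toricPotential S W hW v x₀ =
    toricPotential S W hW v' z - toricPotential S W hW v' x₀ := DFunLike.congr_fun h z
  linarith

theorem toricHorofunction_eq_horoMap (hW : W.Nonempty)
    (hWS : convexHull ℝ (W : Set (EuclideanSpace ℝ (Fin n))) = slackPolyhedron S)
    (hS : N.unitBall = convexHull ℝ (S : Set (EuclideanSpace ℝ (Fin n))))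
    (x₀ : EuclideanSpace ℝ (Fin n)) (v : slackPolyhedron S)
    (hv : ∀ s ∈ S, 0 < slack s (v : EuclideanSpace ℝ (Fin n))) :
    toricHorofunction hW hWS x₀ v = horoMap N.dist N.continuous_dist x₀
      (-∑ s ∈ S, Real.log (slack s (v : EuclideanSpace ℝ (Fin n))) • s) := by
  ext z
  change toricPotential S W hW v z - toricPotential S W hW v x₀ = N.toFun _ - N.toFun _
  rw [toricPotential_of_pos hW hv, toricPotential_of_pos hW hv,
    N.toFun_eq_sup' hW (by rw [hWS, hS, polarSet_convexHull]),
    N.toFun_eq_sup' hW (by rw [hWS, hS, polarSet_convexHull])]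
  ring

theorem exists_neg_sum_log_slack_smul_eq (hK : IsCompact (slackPolyhedron S))
    (x : EuclideanSpace ℝ (Fin n)) :
    ∃ v : slackPolyhedron S, (∀ s ∈ S, 0 < slack s (v : EuclideanSpace ℝ (Fin n))) ∧
      -∑ s ∈ S, Real.log (slack s (v : EuclideanSpace ℝ (Fin n))) • s = x := by
  -- The shift by `∑ s` absorbs the `+ 1` in the derivative of `x log x`.
  obtain ⟨v, hv, h⟩ := exists_sum_log_slack_smul_eq hK (x - ∑ s ∈ S, s)
  refine ⟨⟨v, fun s hs => (hv s hs).le⟩, hv, ?_⟩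
  simp only [add_smul, one_smul, Finset.sum_add_distrib] at h
  rw [neg_eq_iff_eq_neg, ← add_right_cancel_iff (a := ∑ s ∈ S, s), h]
  abel

theorem isClosedEmbedding_toricHorofunction (hK : IsCompact (slackPolyhedron S)) (hW : W.Nonempty)
    (hWS : convexHull ℝ (W : Set (EuclideanSpace ℝ (Fin n))) = slackPolyhedron S)
    (hS : N.unitBall = convexHull ℝ (S : Set (EuclideanSpace ℝ (Fin n))))
    (x₀ : EuclideanSpace ℝ (Fin n)) :
    Topology.IsClosedEmbedding (toricHorofunction hW hWS x₀) := by
  have := isCompact_iff_compactSpace.1 hK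
  exact (continuous_toricHorofunction hW hWS x₀).isClosedEmbedding
    (toricHorofunction_injective N hW hWS hS x₀)

theorem range_toricHorofunction (hK : IsCompact (slackPolyhedron S)) (hW : W.Nonempty)
    (hWS : convexHull ℝ (W : Set (EuclideanSpace ℝ (Fin n))) = slackPolyhedron S)
    (hS : N.unitBall = convexHull ℝ (S : Set (EuclideanSpace ℝ (Fin n))))
    (x₀ : EuclideanSpace ℝ (Fin n)) :
    Set.range (toricHorofunction hW hWS x₀) =
      horofunctionCompactification N.dist N.continuous_dist x₀ := by
  refine Set.Subset.antisymm ?_ (closure_minimal ?_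
    (isClosedEmbedding_toricHorofunction N hK hW hWS hS x₀).isClosed_range)
  · rw [← Set.image_univ, ← (dense_slack_pos S).closure_eq]
    refine (image_closure_subset_closure_image
      (continuous_toricHorofunction hW hWS x₀)).trans (closure_mono ?_)
    rintro _ ⟨v, hv, rfl⟩
    rw [toricHorofunction_eq_horoMap N hW hWS hS x₀ v hv]
    exact Set.mem_range_self _
  · rintro _ ⟨x, rfl⟩
    obtain ⟨v, hv, rfl⟩ := exists_neg_sum_log_slack_smul_eq hK x
    exact ⟨v, toricHorofunction_eq_horoMap N hW hWS hS x₀ v hv⟩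

theorem continuous_horoMap (x₀ : EuclideanSpace ℝ (Fin n)) :
    Continuous (horoMap N.dist N.continuous_dist x₀) := by
  refine ContinuousMap.continuous_of_continuous_uncurry _ ?_
  exact (N.continuous_toFun.comp (by fun_prop : Continuous fun p :
    EuclideanSpace ℝ (Fin n) × EuclideanSpace ℝ (Fin n) => p.1 - p.2)).sub
      (N.continuous_toFun.comp (by fun_prop))

theorem isEmbedding_horoMap (hK : IsCompact (slackPolyhedron S)) (hW : W.Nonempty)
    (hWS : convexHull ℝ (W : Set (EuclideanSpace ℝ (Fin n))) = slackPolyhedron S)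
    (hS : N.unitBall = convexHull ℝ (S : Set (EuclideanSpace ℝ (Fin n))))
    (x₀ : EuclideanSpace ℝ (Fin n)) :
    Topology.IsEmbedding (horoMap N.dist N.continuous_dist x₀) := by
  -- `ψ` factors through the embedding as `toricHorofunction ∘ m`, and `m` has the left inverse `v ↦
  -- -∑ log l_s(v) s`, continuous where slacks are positive. Hence `ψ(y) → ψ(x)` forces `m y → m x`,
  -- then `y → x`.
  choose m hm hmx using exists_neg_sum_log_slack_smul_eq (n := n) hK
  have hemb := (isClosedEmbedding_toricHorofunction N hK hW hWS hS x₀).isEmbedding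
  have hψ : ∀ x, horoMap N.dist N.continuous_dist x₀ x = toricHorofunction hW hWS x₀ (m x) :=
    fun x => by rw [toricHorofunction_eq_horoMap N hW hWS hS x₀ (m x) (hm x), hmx]
  refine ⟨Topology.isInducing_iff_nhds.2 fun x => le_antisymm
    (continuous_horoMap N x₀).continuousAt.le_comap ?_, fun x y hxy => ?_⟩
  · have h1 : Filter.Tendsto m (Filter.comap (horoMap N.dist N.continuous_dist x₀)
        (nhds (horoMap N.dist N.continuous_dist x₀ x))) (nhds (m x)) := by
      rw [hemb.isInducing.nhds_eq_comap, Filter.tendsto_comap_iff]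
      have : toricHorofunction hW hWS x₀ ∘ m = horoMap N.dist N.continuous_dist x₀ :=
        funext fun y => (hψ y).symm
      rw [this, ← hψ]
      exact Filter.tendsto_comap
    have h2 : ContinuousAt (fun v : slackPolyhedron S =>
        -∑ s ∈ S, Real.log (slack s (v : EuclideanSpace ℝ (Fin n))) • s) (m x) := by
      refine ContinuousAt.neg (tendsto_finsetSum _ fun s hs => ?_)
      refine Filter.Tendsto.smul_const (Filter.Tendsto.log ?_ (hm x s hs).ne') s
      exact ((continuous_slack s).comp continuous_subtype_val).continuousAt
    have h3 := h2.tendsto.comp h1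
    rw [hmx] at h3
    have h4 : ((fun v : slackPolyhedron S =>
        -∑ s ∈ S, Real.log (slack s (v : EuclideanSpace ℝ (Fin n))) • s) ∘ m) = id :=
      funext hmx
    rw [h4] at h3
    exact h3
  · rw [hψ, hψ] at hxy
    rw [← hmx x, ← hmx y, hemb.injective hxy]

end Compactification

theorem mainTheorem2 (n : ℕ) (N : AsymmetricNorm (EuclideanSpace ℝ (Fin n)))
    (hN : N.IsRationalPolyhedral) :
    Bornology.IsBounded (polarSet N.unitBall) ∧
      ∀ x₀ : EuclideanSpace ℝ (Fin n),
        Topology.IsEmbedding (horoMap N.dist N.continuous_dist x₀) ∧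
        Nonempty (↥(horofunctionCompactification N.dist N.continuous_dist x₀) ≃ₜ
          ↥(polarSet N.unitBall)) := by
  have hbdd := N.isBounded_polarSet_unitBall
  refine ⟨hbdd, fun x₀ => ?_⟩
  obtain ⟨T, hT, hP⟩ := hN.1
  obtain ⟨S, rfl⟩ := hT.exists_finset_coe
  have hpolar : polarSet N.unitBall = slackPolyhedron S := by rw [hP, polarSet_convexHull]
  rw [hpolar] at hbdd ⊢
  obtain ⟨W, hW, hWS⟩ := exists_convexHull_eq_slackPolyhedron hbdd
  have hK : IsCompact (slackPolyhedron S) :=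
    Metric.isCompact_of_isClosed_isBounded (isClosed_slackPolyhedron S) hbdd
  refine ⟨isEmbedding_horoMap N hK hW hWS hP x₀, ⟨?_⟩⟩
  exact ((isClosedEmbedding_toricHorofunction N hK hW hWS hP x₀).isEmbedding.toHomeomorph.trans
    (Homeomorph.setCongr (range_toricHorofunction N hK hW hWS hP x₀))).symm
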